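/- Let $\mathbb F_q$ be the finite field with $q$ elements. For $A=\begin{pmatrix}a&b\\c&d\end{pmatrix}\in \mathrm{GL}_2(\mathbb F_q)$ and a nonzero polynomial $f\in\mathbb F_q[x]$ of degree $k$, put $A\circ f=(bx+d)^k f\!\left(\frac{ax+c}{bx+d}\right)$, a nonzero polynomial, and let $[A]\circ f$ be the monic scalar multiple of $A\circ f$; it depends only on $f$ and on the class $[A]$ of $A$ in $\mathrm{PGL}_2(\mathbb F_q)$. Let $N_A(n)$, for $n\ge 2$, be the number of monic irreducible polynomials $f\in\mathbb F_q[x]$ of degree $n$ with $[A]\circ f=f$. The matrix $A$ is said to be of type $4$ if $[A]\neq[I]$ and its eigenvalues lie in $\mathbb F_{q^2}\setminus\mathbb F_q$ and are not negatives of each other. **Theorem.** Let $A\in\mathrm{GL}_2(\mathbb F_q)$ be of type $4$ and let $D$ be the order of $[A]$ in $\mathrm{PGL}_2(\mathbb F_q)$. Then $N_A(n)=0$ for every integer $n>2$ that is not divisible by $D$, and for every integer $m\ge 1$, $$N_A(Dm)=\frac{\varphi(D)}{Dm}\sum_{\substack{d\mid m\\ \gcd(d,D)=1}}\left(q^{m/d}+(-1)^{m/d+1}\right)\mu(d),$$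 where $\varphi$ is Euler's totient function and $\mu$ is the Möbius function. -/

import Mathlib

open Polynomial
open scoped MatrixGroups

namespace MobiusPoly

noncomputable section

/-- For `A = (a b; c d)` and `f = ∑ aᵢ xⁱ` of degree `k`, the polynomial
`A ∘ f = (b x + d)ᵏ f((a x + c) / (b x + d)) = ∑ aᵢ (a x + c)ⁱ (b x + d)ᵏ⁻ⁱ`. -/
def act {F : Type*} [Field F] (A : GL (Fin 2) F) (f : F[X]) : F[X] :=
  ∑ i ∈ Finset.range (f.natDegree + 1),
    C (f.coeff i) * (C (A 0 0) * X + C (A 1 0)) ^ i *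
      (C (A 0 1) * X + C (A 1 1)) ^ (f.natDegree - i)

/-- `[A] ∘ f`: the monic scalar multiple of `A ∘ f`. -/
def projAct {F : Type*} [Field F] (A : GL (Fin 2) F) (f : F[X]) : F[X] :=
  C (act A f).leadingCoeff⁻¹ * act A f

/-- The set of `[A]`-invariants of degree `n`: the monic irreducible polynomials `f` of degree `n`
with `[A] ∘ f = f`. -/
def invariants {F : Type*} [Field F] (A : GL (Fin 2) F) (n : ℕ) : Set F[X] :=
  {f | f.Monic ∧ Irreducible f ∧ f.natDegree = n ∧ projAct A f = f}

/-- The number of `[A]`-invariants of degree `n`. -/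
def numInvariants {F : Type*} [Field F] (A : GL (Fin 2) F) (n : ℕ) : ℕ :=
  (invariants A n).ncard

/-- `A` is of type 4 (over the finite field `F` with `q` elements): `[A] ≠ [I]`, and the two
eigenvalues `α, β` of `A` (with multiplicity, in an algebraic closure of `F`) lie in
`𝔽_{q²} \ 𝔽_q` and are not symmetric, that is, `β ≠ -α`.
Here `𝔽_{q²} = {x | x ^ q² = x}`. -/
def IsType4 {F : Type*} [Field F] (A : GL (Fin 2) F) : Prop :=
  (Matrix.ProjGenLinGroup.mk A : PGL(2, F)) ≠ 1 ∧
  ∃ α β : AlgebraicClosure F,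
    (A : Matrix (Fin 2) (Fin 2) F).charpoly.aroots (AlgebraicClosure F) = {α, β} ∧
    (α ^ Nat.card F ^ 2 = α ∧ α ∉ Set.range (algebraMap F (AlgebraicClosure F))) ∧
    (β ^ Nat.card F ^ 2 = β ∧ β ∉ Set.range (algebraMap F (AlgebraicClosure F))) ∧
    β ≠ -α

/-- Over a finite field there are only finitely many invariants of a given degree, so
`numInvariants` is their actual number. -/
theorem invariants_finite {F : Type*} [Field F] [Finite F] (A : GL (Fin 2) F) (n : ℕ) :
    (invariants A n).Finite := by
  have : Finite (degreeLT F (n + 1)) := Finite.of_equiv _ (degreeLTEquiv F (n + 1)).symm.toEquiv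
  refine (Set.toFinite (degreeLT F (n + 1) : Set F[X])).subset ?_
  rintro f ⟨_, _, hn, _⟩
  rw [SetLike.mem_coe, mem_degreeLT]
  exact lt_of_le_of_lt degree_le_natDegree (by rw [hn]; exact_mod_cast Nat.lt_succ_self n)

/-- `[A] ∘ f` depends only on the class of `A` modulo scalars. -/
theorem projAct_eq_of_smul {F : Type*} [Field F] (A B : GL (Fin 2) F) (c : F) (hc : c ≠ 0)
    (h : ∀ i j, B i j = c * A i j) (f : F[X]) : projAct B f = projAct A f := by
  have key : act B f = C (c ^ f.natDegree) * act A f := by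
    unfold act
    rw [Finset.mul_sum]
    refine Finset.sum_congr rfl fun i hi => ?_
    have hi' : i + (f.natDegree - i) = f.natDegree := by
      have := Finset.mem_range.1 hi
      omega
    conv_rhs => rw [show c ^ f.natDegree = c ^ i * c ^ (f.natDegree - i) by rw [← pow_add, hi']]
    have e1 : C (B 0 0) * X + C (B 1 0) = C c * (C (A 0 0) * X + C (A 1 0)) := by
      rw [h, h, C_mul, C_mul]; ring
    have e2 : C (B 0 1) * X + C (B 1 1) = C c * (C (A 0 1) * X + C (A 1 1)) := by
      rw [h, h, C_mul, C_mul]; ring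
    rw [e1, e2, mul_pow, mul_pow, C_mul, C_pow, C_pow]
    ring
  have hk : c ^ f.natDegree ≠ 0 := pow_ne_zero _ hc
  unfold projAct
  rw [key, leadingCoeff_mul, leadingCoeff_C, mul_inv, ← mul_assoc, ← C_mul]
  congr 2
  field_simp

end

end MobiusPoly

namespace MobiusPoly

/-! Let `φ` be the `q`-Frobenius on an algebraic closure and `s` the Möbius map of `A`; they
commute. On a point of degree `n > 2`, `φ` has period `n` and `s` has period `D`
(`minimalPeriod_pow_card`, `minimalPeriod_mob`). A monic irreducible `f` of such a degree is
invariant iff `s` sends a root `x` to a conjugate `φ^j x`. Comparing periods gives `D = n / gcd(n,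
j)`, so `D ∣ n`. For the formula, count in two ways the points of degree `> 2` with `s^l x = φ^m x`
for some `l` coprime to `D`. The `φ(D)` residues of `l` give disjoint sets. Each consists of the
roots of a separable polynomial of degree `q^m + 1`, minus its roots of degree two: two of them for
even `m`, none for odd `m`, so `q^m + (-1)^(m+1)` remain (`ncard_mob_eq_pow`). On the other hand
`exists_coprime_iterate_eq_iff` identifies these points with the roots of the invariants of degree
`D(m/t)`, for `t ∣ m` coprime to `D`. Möbius inversion restricted to divisors coprime to `D`
(`eq_sum_coprime_moebius`) isolates `N_A(Dm)`. Type 4 enters only through two facts: `A` has no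
eigenvalue in the base field, and its trace is nonzero. -/

theorem exists_mul_modEq_one {l D : ℕ} (h : l.Coprime D) (hD : 0 < D) :
    ∃ k, l * k ≡ 1 [MOD D] := by
  rcases Nat.lt_or_ge 1 D with h1 | h1
  · obtain ⟨k, -, hk⟩ := Nat.exists_mul_mod_eq_one_of_coprime h h1
    exact ⟨k, by rw [Nat.ModEq, hk, Nat.mod_eq_of_lt h1]⟩
  · obtain rfl : D = 1 := by omega
    exact ⟨0, Nat.modEq_one⟩

/-! ### Periods of two commuting maps along a common orbit -/

section Dynamics

open Function

variable {α : Type*} {φ s : α → α} {x : α}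

theorem iterate_iterate_eq_of_commute (h : Function.Commute s φ) {l m : ℕ}
    (hx : s^[l] x = φ^[m] x) (k : ℕ) : s^[l * k] x = φ^[m * k] x := by
  rw [iterate_mul, iterate_mul]
  induction k with
  | zero => rfl
  | succ k ih =>
    rw [iterate_succ_apply', ih, iterate_succ_apply, ← hx]
    exact ((h.iterate_iterate l m).iterate_right k).eq x

theorem minimalPeriod_iterate_eq_of_commute (h : Function.Commute s φ) {l m : ℕ}
    (hx : s^[l] x = φ^[m] x) : minimalPeriod s^[l] x = minimalPeriod φ^[m] x := by
  rw [minimalPeriod_eq_minimalPeriod_iff]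
  intro k
  have := iterate_iterate_eq_of_commute h hx k
  rw [iterate_mul, iterate_mul] at this
  rw [IsPeriodicPt, IsFixedPt, IsPeriodicPt, IsFixedPt, this]

theorem eq_div_gcd_of_commute (h : Function.Commute s φ) (hφ : 0 < minimalPeriod φ x) {j : ℕ}
    (hx : s x = φ^[j] x) :
    minimalPeriod s x = minimalPeriod φ x / (minimalPeriod φ x).gcd j := by
  have := minimalPeriod_iterate_eq_of_commute (l := 1) h hx
  rw [iterate_one] at this
  rw [this, minimalPeriod_iterate_eq_div_gcd' (minimalPeriod_pos_iff_mem_periodicPts.1 hφ)]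

theorem iterate_eq_iterate_iff_modEq (hφ : 0 < minimalPeriod φ x) {i j : ℕ} :
    φ^[i] x = φ^[j] x ↔ i ≡ j [MOD minimalPeriod φ x] := by
  rw [← iterate_mod_minimalPeriod_eq, ← iterate_mod_minimalPeriod_eq (n := j),
    iterate_eq_iterate_iff_of_lt_minimalPeriod (Nat.mod_lt _ hφ) (Nat.mod_lt _ hφ), Nat.ModEq]

/-- Inverting `l` modulo `D` turns `s^l x = φ^m x` into `s x = φ^j x`. Since `s^l` still has period
`D`, comparison with the period of `φ^m` gives `D = n / gcd(n, m)`, where `n` is the `φ`-period, and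
`t = m / gcd(n, m)`. This bridges the two counts. -/
theorem exists_coprime_iterate_eq_iff (h : Function.Commute s φ) (hφ : 0 < minimalPeriod φ x)
    {D : ℕ} (hD : minimalPeriod s x = D) (hD0 : 0 < D) {m : ℕ} (hm : 0 < m) :
    (∃ l, l.Coprime D ∧ s^[l] x = φ^[m] x) ↔
      (∃ j, s x = φ^[j] x) ∧
        ∃ t, t ∣ m ∧ t.Coprime D ∧ minimalPeriod φ x = D * (m / t) := by
  have hs : 0 < minimalPeriod s x := hD ▸ hD0
  have hφ' := minimalPeriod_pos_iff_mem_periodicPts.1 hφ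
  have hs' := minimalPeriod_pos_iff_mem_periodicPts.1 hs
  constructor
  · rintro ⟨l, hl, hlm⟩
    constructor
    · obtain ⟨k, hk⟩ := exists_mul_modEq_one hl hD0
      refine ⟨m * k, ?_⟩
      rw [← iterate_iterate_eq_of_commute h hlm k]
      conv_lhs => rw [← iterate_one s]
      rw [iterate_eq_iterate_iff_modEq hs, hD]
      exact hk.symm
    · have e := minimalPeriod_iterate_eq_of_commute h hlm
      rw [minimalPeriod_iterate_eq_div_gcd' hs', minimalPeriod_iterate_eq_div_gcd' hφ', hD,
        Nat.gcd_comm D, hl, Nat.div_one] at e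
      set n := minimalPeriod φ x
      obtain ⟨g, n', t, hg, hco, hn, ht⟩ := Nat.exists_coprime' (m := n) (n := m)
        (Nat.gcd_pos_of_pos_left _ hφ)
      have hgn : n.gcd m = g := by
        rw [hn, ht, Nat.gcd_mul_right, hco, one_mul]
      have hn' : D = n' := by
        rw [e, hgn, hn, Nat.mul_div_cancel _ hg]
      have ht0 : 0 < t := by
        rcases Nat.eq_zero_or_pos t with h | h
        · simp [h] at ht; omega
        · exact h
      refine ⟨t, ⟨g, ht⟩, hn' ▸ hco.symm, ?_⟩
      rw [hn, hn', ht, Nat.mul_div_cancel_left _ ht0]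
  · rintro ⟨⟨j, hj⟩, t, ⟨g, rfl⟩, htD, hn⟩
    have ht0 : 0 < t := Nat.pos_of_mul_pos_right hm
    have hg0 : 0 < g := Nat.pos_of_mul_pos_left hm
    rw [Nat.mul_div_cancel_left _ ht0] at hn
    have e := eq_div_gcd_of_commute h hφ hj
    rw [hD, hn] at e
    have hgcd : (D * g).gcd j = g := by
      have h1 : (D * g).gcd j ∣ D * g := Nat.gcd_dvd_left _ _
      have h2 := Nat.div_mul_cancel h1
      rw [← e] at h2
      exact Nat.eq_of_mul_eq_mul_left hD0 h2
    obtain ⟨k, rfl⟩ : g ∣ j := hgcd ▸ Nat.gcd_dvd_right _ _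
    have hk : k.Coprime D := by
      rw [mul_comm D g, Nat.gcd_mul_left] at hgcd
      rw [Nat.coprime_comm]
      exact Nat.eq_of_mul_eq_mul_left hg0 (by rw [hgcd, mul_one])
    obtain ⟨k', hk'⟩ := exists_mul_modEq_one hk hD0
    have hk'' : k'.Coprime D := by
      have : (k * k').Coprime D := by
        rw [Nat.Coprime, Nat.ModEq.gcd_eq hk', Nat.gcd_one_left]
      exact Nat.Coprime.coprime_mul_left this
    -- With `j = g k` and `k k' ≡ 1` mod `D`, one has `g k k' t ≡ g t` modulo the `φ`-period `D g`,
    -- and `g t` is the given exponent.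
    refine ⟨k' * t, Nat.Coprime.mul_left hk'' htD, ?_⟩
    have := iterate_iterate_eq_of_commute (l := 1) h hj (k' * t)
    rw [one_mul] at this
    rw [this, iterate_eq_iterate_iff_modEq hφ, hn]
    have := (hk'.mul_right t).mul_left' g
    rw [one_mul, mul_comm g D] at this
    convert this using 1 <;> ring

end Dynamics

/-! ### Möbius inversion over divisors coprime to `D` -/

section Inversion

open ArithmeticFunction

/-- The indicator `χ` of coprimality to `D` is completely multiplicative, so its Dirichlet inverse
is `μ χ`. -/
theorem eq_sum_coprime_moebius {D : ℕ} {f g : ℕ → ℚ}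
    (h : ∀ m, 0 < m → f m = ∑ t ∈ m.divisors with Nat.gcd t D = 1, g (m / t)) {m : ℕ}
    (hm : 0 < m) :
    g m = ∑ d ∈ m.divisors with Nat.gcd d D = 1,
      f (m / d) * ((ArithmeticFunction.moebius d : ℤ) : ℚ) := by
  classical
  let G : ArithmeticFunction ℚ := ⟨fun n => if n = 0 then 0 else g n, by simp⟩
  let E : ArithmeticFunction ℚ := ⟨fun n => if n = 0 then 0 else f n, by simp⟩
  let χ : ArithmeticFunction ℚ := ⟨fun n => if n ≠ 0 ∧ Nat.gcd n D = 1 then 1 else 0, by simp⟩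
  let M : ArithmeticFunction ℚ :=
    ⟨fun n => if Nat.gcd n D = 1 then ((ArithmeticFunction.moebius n : ℤ) : ℚ) else 0, by simp⟩
  have hE : E = χ * G := by
    ext n
    rcases Nat.eq_zero_or_pos n with rfl | hn
    · simp
    rw [ArithmeticFunction.mul_apply, Nat.sum_divisorsAntidiagonal (fun a b => χ a * G b)]
    simp only [E, χ, G, ArithmeticFunction.coe_mk, if_neg hn.ne', h n hn, Finset.sum_filter]
    refine Finset.sum_congr rfl fun d hd => ?_
    have hd' := Nat.dvd_of_mem_divisors hd
    have h0 : n / d ≠ 0 := (Nat.div_pos (Nat.le_of_dvd hn hd') (Nat.pos_of_mem_divisors hd)).ne'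
    have h1 : d ≠ 0 := (Nat.pos_of_mem_divisors hd).ne'
    simp [h0, h1]
  have hM : M * χ = 1 := by
    have key := coe_moebius_mul_coe_zeta (R := ℚ)
    ext n
    rcases Nat.eq_zero_or_pos n with rfl | hn
    · simp
    have : (M * χ) n = χ n * ((moebius : ArithmeticFunction ℚ) * (zeta : ArithmeticFunction ℚ)) n := by
      rw [ArithmeticFunction.mul_apply, ArithmeticFunction.mul_apply, Finset.mul_sum]
      refine Finset.sum_congr rfl fun p hp => ?_
      obtain ⟨hp, -⟩ := Nat.mem_divisorsAntidiagonal.1 hp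
      have h1 : p.1 ≠ 0 := by rintro h; simp [h] at hp; omega
      have h2 : p.2 ≠ 0 := by rintro h; simp [h] at hp; omega
      have h3 : Nat.gcd n D = 1 ↔ Nat.gcd p.1 D = 1 ∧ Nat.gcd p.2 D = 1 := by
        rw [← hp]; exact Nat.coprime_mul_iff_left
      by_cases ha : Nat.gcd p.1 D = 1 <;> by_cases hb : Nat.gcd p.2 D = 1 <;>
        simp [M, χ, h3, ha, hb, h2, hn.ne']
    rw [this, key]
    by_cases h1 : n = 1
    · simp [h1, χ]
    · simp [h1]
  have hG : G = M * E := by rw [hE, ← mul_assoc, hM, one_mul]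
  have := congrArg (fun F : ArithmeticFunction ℚ => F m) hG
  simp only [ArithmeticFunction.mul_apply] at this
  rw [Nat.sum_divisorsAntidiagonal (fun a b => M a * E b)] at this
  simp only [G, ArithmeticFunction.coe_mk, if_neg hm.ne'] at this
  rw [this, Finset.sum_filter]
  refine Finset.sum_congr rfl fun d hd => ?_
  have hd' := Nat.dvd_of_mem_divisors hd
  have h0 : m / d ≠ 0 := (Nat.div_pos (Nat.le_of_dvd hm hd') (Nat.pos_of_mem_divisors hd)).ne'
  simp only [M, E, ArithmeticFunction.coe_mk, if_neg h0]
  split_ifs <;> ring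

end Inversion

end MobiusPoly

/-! ### Möbius transformations and the action on polynomials -/

namespace MobiusPoly

variable {F K : Type*} [Field F] [Field K] [Algebra F K]

theorem det_entries_ne_zero (A : GL (Fin 2) F) : A 0 0 * A 1 1 - A 0 1 * A 1 0 ≠ 0 := by
  have := A.det.ne_zero
  rwa [Matrix.GeneralLinearGroup.val_det_apply, Matrix.det_fin_two] at this

theorem mk_eq_one_iff_entries (A : GL (Fin 2) F) :
    (Matrix.ProjGenLinGroup.mk A : PGL(2, F)) = 1 ↔ A 0 1 = 0 ∧ A 1 0 = 0 ∧ A 0 0 = A 1 1 := by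
  rw [Matrix.ProjGenLinGroup.mk_eq_one, Matrix.GeneralLinearGroup.center_eq_range_scalar]
  constructor
  · rintro ⟨u, rfl⟩
    simp
  · rintro ⟨h1, h2, h3⟩
    have h0 : A 0 0 ≠ 0 := fun h => det_entries_ne_zero A (by rw [h, h1]; ring)
    refine ⟨Units.mk0 _ h0, ?_⟩
    ext i j
    fin_cases i <;> fin_cases j <;> simp [h1, h2, h3]

theorem exists_pow_apply_eq (A : GL (Fin 2) F) (l : ℕ) :
    ∃ p r : F, (A ^ l) 0 0 = p + r * A 0 0 ∧ (A ^ l) 0 1 = r * A 0 1 ∧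
      (A ^ l) 1 0 = r * A 1 0 ∧ (A ^ l) 1 1 = p + r * A 1 1 := by
  induction l with
  | zero => exact ⟨1, 0, by simp⟩
  | succ l ih =>
    obtain ⟨p, r, h00, h01, h10, h11⟩ := ih
    -- Cayley–Hamilton: `A² = tr(A) A - det(A) I` updates the coefficients in `A^l = p I + r A`.
    refine ⟨-r * (A 0 0 * A 1 1 - A 0 1 * A 1 0), p + r * (A 0 0 + A 1 1), ?_⟩
    simp only [pow_succ, Matrix.GeneralLinearGroup.coe_mul, Matrix.mul_apply, Fin.sum_univ_two,
      h00, h01, h10, h11]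
    refine ⟨?_, ?_, ?_, ?_⟩ <;> ring

/-- The Möbius transformation `x ↦ (a x + c) / (b x + d)` attached to `A = (a b; c d)`. -/
noncomputable def mob (A : GL (Fin 2) F) (x : K) : K :=
  (algebraMap F K (A 0 0) * x + algebraMap F K (A 1 0)) /
    (algebraMap F K (A 0 1) * x + algebraMap F K (A 1 1))

theorem eq_zero_of_mul_add_eq_zero {x : K} (hx : x ∉ Set.range (algebraMap F K)) {b d : F}
    (h : algebraMap F K b * x + algebraMap F K d = 0) : b = 0 ∧ d = 0 := by
  have hb : b = 0 := by
    by_contra hb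
    have hb' : algebraMap F K b ≠ 0 := by simpa using hb
    refine hx ⟨-d / b, ?_⟩
    rw [map_div₀, map_neg, div_eq_iff hb']
    linear_combination -h
  subst hb
  simpa using h

theorem denom_ne_zero (A : GL (Fin 2) F) {x : K} (hx : x ∉ Set.range (algebraMap F K)) :
    algebraMap F K (A 0 1) * x + algebraMap F K (A 1 1) ≠ 0 := by
  intro h
  obtain ⟨h1, h2⟩ := eq_zero_of_mul_add_eq_zero hx h
  exact det_entries_ne_zero A (by rw [h1, h2]; ring)

theorem mob_notMem_range (A : GL (Fin 2) F) {x : K} (hx : x ∉ Set.range (algebraMap F K)) :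
    mob A x ∉ Set.range (algebraMap F K) := by
  rintro ⟨y, hy⟩
  rw [mob, eq_div_iff (denom_ne_zero A hx)] at hy
  obtain ⟨h1, h2⟩ := eq_zero_of_mul_add_eq_zero (b := A 0 0 - y * A 0 1)
    (d := A 1 0 - y * A 1 1) hx (by simp only [map_sub, map_mul]; linear_combination -hy)
  exact det_entries_ne_zero A (by linear_combination A 1 1 * h1 - A 0 1 * h2)

theorem mob_one (x : K) : mob (1 : GL (Fin 2) F) x = x := by simp [mob]

theorem mob_mul (A B : GL (Fin 2) F) {x : K} (hx : x ∉ Set.range (algebraMap F K)) :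
    mob (A * B) x = mob B (mob A x) := by
  have h := denom_ne_zero A hx
  rw [mob, mob, ← mul_div_mul_right _ (algebraMap F K (B 0 1) * mob A x + _) h]
  have e : mob A x * (algebraMap F K (A 0 1) * x + algebraMap F K (A 1 1)) =
    algebraMap F K (A 0 0) * x + algebraMap F K (A 1 0) := div_mul_cancel₀ _ h
  simp only [Matrix.GeneralLinearGroup.coe_mul, Matrix.mul_apply, Fin.sum_univ_two, map_add,
    map_mul]
  congr 1
  · linear_combination -algebraMap F K (B 0 0) * e
  · linear_combination -algebraMap F K (B 0 1) * e

theorem iterate_mob (A : GL (Fin 2) F) {x : K} (hx : x ∉ Set.range (algebraMap F K)) (k : ℕ) :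
    (mob A)^[k] x = mob (A ^ k) x := by
  induction k with
  | zero => simp [mob_one]
  | succ k ih => rw [Function.iterate_succ_apply', ih, pow_succ, mob_mul _ _ hx]

theorem notMem_range_of_one_lt_natDegree {x : K} (hx : 1 < (minpoly F x).natDegree) :
    x ∉ Set.range (algebraMap F K) := by
  rintro ⟨y, rfl⟩
  rw [minpoly.eq_X_sub_C, natDegree_X_sub_C] at hx
  omega

theorem natDegree_minpoly_le_two {x : K} {p q r : F}
    (h : algebraMap F K p * x ^ 2 + algebraMap F K q * x + algebraMap F K r = 0)
    (hne : ¬ (p = 0 ∧ q = 0 ∧ r = 0)) : (minpoly F x).natDegree ≤ 2 := by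
  have h0 : C p * X ^ 2 + C q * X + C r ≠ 0 := by
    intro h0
    refine hne ⟨?_, ?_, ?_⟩
    · simpa using congrArg (fun f => coeff f 2) h0
    · simpa using congrArg (fun f => coeff f 1) h0
    · simpa using congrArg (fun f => coeff f 0) h0
  exact (natDegree_le_natDegree (minpoly.degree_le_of_ne_zero F x h0 (by simpa using h))).trans
    natDegree_quadratic_le

theorem mob_eq_self_iff (A : GL (Fin 2) F) {x : K} (hx : x ∉ Set.range (algebraMap F K)) :
    mob A x = x ↔ algebraMap F K (A 0 1) * x ^ 2 + algebraMap F K (A 1 1 - A 0 0) * x +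
      algebraMap F K (-A 1 0) = 0 := by
  rw [mob, div_eq_iff (denom_ne_zero A hx)]
  simp only [map_sub, map_neg]
  constructor <;> intro h <;> linear_combination -h

/-- A fixed point of the map of `A^k` is a root of a quadratic over `F`. Degree above two forces
that quadratic to vanish, which says that `A^k` is scalar. -/
theorem minimalPeriod_mob (A : GL (Fin 2) F) {x : K} (hx : 2 < (minpoly F x).natDegree) :
    Function.minimalPeriod (mob A) x = orderOf (Matrix.ProjGenLinGroup.mk A : PGL(2, F)) := by
  have hx' := notMem_range_of_one_lt_natDegree (by omega : 1 < (minpoly F x).natDegree)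
  refine Nat.dvd_right_iff_eq.1 fun k => ?_
  rw [← Function.isPeriodicPt_iff_minimalPeriod_dvd, orderOf_dvd_iff_pow_eq_one, ← map_pow,
    mk_eq_one_iff_entries, Function.IsPeriodicPt, Function.IsFixedPt, iterate_mob A hx',
    mob_eq_self_iff _ hx']
  constructor
  · intro h
    by_contra hne
    refine hx.not_ge (natDegree_minpoly_le_two h ?_)
    rintro ⟨h1, h2, h3⟩
    exact hne ⟨h1, neg_eq_zero.1 h3, (sub_eq_zero.1 h2).symm⟩
  · rintro ⟨h1, h2, h3⟩
    simp [h1, h2, h3]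

theorem aeval_act (A : GL (Fin 2) F) (f : F[X]) {x : K} (hx : x ∉ Set.range (algebraMap F K)) :
    aeval x (act A f) = (algebraMap F K (A 0 1) * x + algebraMap F K (A 1 1)) ^ f.natDegree *
      aeval (mob A x) f := by
  have h := denom_ne_zero A hx
  rw [act, map_sum, aeval_eq_sum_range, Finset.mul_sum]
  refine Finset.sum_congr rfl fun i hi => ?_
  have hi' : f.natDegree - i + i = f.natDegree := by
    have := Finset.mem_range.1 hi
    omega
  conv_rhs => rw [← hi']
  simp only [Algebra.smul_def, mob, div_pow, pow_add, map_mul, map_pow, map_add, aeval_C, aeval_X]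
  generalize algebraMap F K (A 0 1) * x + algebraMap F K (A 1 1) = v at h ⊢
  field_simp

theorem natDegree_act_le (A : GL (Fin 2) F) (f : F[X]) : (act A f).natDegree ≤ f.natDegree := by
  refine natDegree_sum_le_of_forall_le _ _ fun i hi => ?_
  have hi' : i + (f.natDegree - i) = f.natDegree := by
    have := Finset.mem_range.1 hi
    omega
  refine natDegree_mul_le.trans ?_
  rw [← hi']
  refine add_le_add (natDegree_C_mul_le _ _ |>.trans ?_) ?_
  · exact (natDegree_pow_le_of_le i natDegree_linear_le).trans (by simp)
  · exact (natDegree_pow_le_of_le _ natDegree_linear_le).trans (by omega)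

/-- Pick `z` outside `F` that is not a root of `f`. At the preimage of `z` under the Möbius map,
`act A f` is a nonzero multiple of `f(z)`. -/
theorem act_ne_zero [Finite F] [IsAlgClosed K] (A : GL (Fin 2) F) {f : F[X]} (hf : f ≠ 0) :
    act A f ≠ 0 := by
  intro h0
  have hinf : Infinite K := IsAlgClosed.instInfinite
  obtain ⟨z, hz⟩ := ((Set.finite_range (algebraMap F K)).union
    (f.rootSet_finite K)).exists_notMem
  rw [Set.mem_union, not_or] at hz
  refine hz.2 ((mem_rootSet_of_ne hf).2 ?_)
  have h := aeval_act A f (mob_notMem_range A⁻¹ hz.1)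
  rw [h0, map_zero, ← mob_mul _ _ hz.1, inv_mul_cancel, mob_one, eq_comm, mul_eq_zero] at h
  exact h.resolve_left (pow_ne_zero _ (denom_ne_zero A (mob_notMem_range A⁻¹ hz.1)))

theorem projAct_eq_self_iff [Finite F] [IsAlgClosed K] (A : GL (Fin 2) F) {f : F[X]}
    (hf : f.Monic) (hi : Irreducible f) {x : K} (hx : x ∉ Set.range (algebraMap F K))
    (hfx : aeval x f = 0) : projAct A f = f ↔ aeval (mob A x) f = 0 := by
  have hact := aeval_act A f hx
  have h0 : (act A f).leadingCoeff ≠ 0 :=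
    leadingCoeff_ne_zero.2 (act_ne_zero (K := K) A hf.ne_zero)
  constructor
  · intro h
    have := congrArg (aeval x) h
    rw [projAct, map_mul, hfx, aeval_C, hact, mul_eq_zero, mul_eq_zero] at this
    exact (this.resolve_left (by simpa using h0)).resolve_left (pow_ne_zero _ (denom_ne_zero A hx))
  · intro h
    -- Divisibility together with the degree bound makes `act A f` a scalar multiple of `f`.
    have hdvd : f ∣ act A f := by
      rw [minpoly.eq_of_irreducible_of_monic hi hfx hf]
      apply minpoly.dvd
      rw [← minpoly.eq_of_irreducible_of_monic hi hfx hf, hact, h, mul_zero]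
    rw [projAct, eq_leadingCoeff_mul_of_monic_of_dvd_of_natDegree_le hf hdvd
      (natDegree_act_le A f), leadingCoeff_mul, hf.leadingCoeff, leadingCoeff_C, mul_one,
      ← mul_assoc, ← C_mul, inv_mul_cancel₀ h0, C_1, one_mul]

/-! ### Frobenius orbits, conjugates and roots of invariants -/

section Frobenius

open Function

theorem exists_algHom_eq_pow_card [Finite F] :
    ∃ σ : K →ₐ[F] K, ∀ x, σ x = x ^ Nat.card F := by
  have := Fintype.ofFinite F
  exact ⟨FiniteField.frobeniusAlgHom F K, fun x => by
    rw [FiniteField.coe_frobeniusAlgHom, Nat.card_eq_fintype_card]⟩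

theorem mob_commute_pow_card [Finite F] (A : GL (Fin 2) F) :
    Function.Commute (mob (K := K) A) (· ^ Nat.card F) := by
  obtain ⟨σ, hσ⟩ := exists_algHom_eq_pow_card (F := F) (K := K)
  intro x
  simp only [mob, ← hσ, map_div₀, map_add, map_mul, AlgHom.commutes]

variable [Finite F] [Algebra.IsAlgebraic F K]

theorem minimalPeriod_pow_card (x : K) :
    minimalPeriod (· ^ Nat.card F) x = (minpoly F x).natDegree := by
  have hx : IsIntegral F x := Algebra.IsIntegral.isIntegral x
  refine Nat.dvd_right_iff_eq.1 fun n => ?_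
  rw [← isPeriodicPt_iff_minimalPeriod_dvd,
    (minpoly.irreducible hx).natDegree_dvd_iff_dvd_X_pow_card_pow_sub_X, minpoly.dvd_iff,
    IsPeriodicPt, IsFixedPt, pow_iterate]
  simp [sub_eq_zero]

theorem pow_card_pow_eq_self_iff (x : K) (n : ℕ) :
    x ^ Nat.card F ^ n = x ↔ (minpoly F x).natDegree ∣ n := by
  rw [← minimalPeriod_pow_card, ← isPeriodicPt_iff_minimalPeriod_dvd, IsPeriodicPt, IsFixedPt,
    pow_iterate]

theorem aeval_minpoly_eq_zero_iff (x y : K) :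
    aeval y (minpoly F x) = 0 ↔ ∃ j, y = (· ^ Nat.card F)^[j] x := by
  classical
  have hx : IsIntegral F x := Algebra.IsIntegral.isIntegral x
  have hroot : ∀ j, aeval ((· ^ Nat.card F)^[j] x) (minpoly F x) = 0 := by
    obtain ⟨σ, hσ⟩ := exists_algHom_eq_pow_card (F := F) (K := K)
    intro j
    induction j with
    | zero => simp
    | succ j ih => rw [iterate_succ_apply', ← hσ, aeval_algHom_apply, ih, map_zero]
  constructor
  · intro hy
    -- The first `deg` Frobenius iterates are distinct roots, so they already exhaust the roots.
    have hsub : (Finset.range (minpoly F x).natDegree).image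
        (fun j => (· ^ Nat.card F)^[j] x) ⊆ ((minpoly F x).aroots K).toFinset := by
      intro z hz
      obtain ⟨j, -, rfl⟩ := Finset.mem_image.1 hz
      rw [Multiset.mem_toFinset, mem_aroots]
      exact ⟨minpoly.ne_zero hx, hroot j⟩
    have hcard : ((minpoly F x).aroots K).toFinset.card ≤
        ((Finset.range (minpoly F x).natDegree).image (fun j => (· ^ Nat.card F)^[j] x)).card := by
      rw [Finset.card_image_of_injOn, Finset.card_range]
      · refine (Multiset.toFinset_card_le _).trans ((card_roots' _).trans ?_)
        rw [natDegree_map]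
      · intro i hi j hj hij
        rw [← minimalPeriod_pow_card] at hi hj
        exact iterate_injOn_Iio_minimalPeriod (by simpa using hi) (by simpa using hj) hij
    have hmem : y ∈ ((minpoly F x).aroots K).toFinset := by
      rw [Multiset.mem_toFinset, mem_aroots]
      exact ⟨minpoly.ne_zero hx, hy⟩
    rw [← Finset.eq_of_subset_of_card_le hsub hcard] at hmem
    obtain ⟨j, -, hj⟩ := Finset.mem_image.1 hmem
    exact ⟨j, hj.symm⟩
  · rintro ⟨j, rfl⟩
    exact hroot j

theorem minpoly_mem_invariants_iff [IsAlgClosed K] (A : GL (Fin 2) F) (x : K) {n : ℕ}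
    (hn : 2 < n) :
    minpoly F x ∈ invariants A n ↔
      (minpoly F x).natDegree = n ∧ ∃ j, mob A x = (· ^ Nat.card F)^[j] x := by
  have hx : IsIntegral F x := Algebra.IsIntegral.isIntegral x
  have key : (minpoly F x).natDegree = n → (projAct A (minpoly F x) = minpoly F x ↔
      ∃ j, mob A x = (· ^ Nat.card F)^[j] x) := by
    intro h
    rw [projAct_eq_self_iff A (minpoly.monic hx) (minpoly.irreducible hx)
      (notMem_range_of_one_lt_natDegree (by omega)) (minpoly.aeval F x),
      aeval_minpoly_eq_zero_iff]
  constructor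
  · rintro ⟨-, -, h, h'⟩
    exact ⟨h, (key h).1 h'⟩
  · rintro ⟨h, h'⟩
    exact ⟨minpoly.monic hx, minpoly.irreducible hx, h, (key h).2 h'⟩

theorem card_roots_eq_mul_numInvariants [IsAlgClosed K] (A : GL (Fin 2) F) (n : ℕ) :
    {x : K | minpoly F x ∈ invariants A n}.ncard = n * numInvariants A n := by
  classical
  have hfib : ∀ f ∈ invariants A n, {x : K | minpoly F x = f} = f.rootSet K := by
    rintro f ⟨hf, hi, -, -⟩
    ext x
    rw [Set.mem_ofPred_eq, mem_rootSet_of_ne hf.ne_zero]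
    exact ⟨fun h => h ▸ minpoly.aeval F x,
      fun h => (minpoly.eq_of_irreducible_of_monic hi h hf).symm⟩
  have hunion : {x : K | minpoly F x ∈ invariants A n} =
      ((invariants_finite A n).toFinset.biUnion fun f => (f.aroots K).toFinset : Finset K) := by
    ext x
    simp only [Set.mem_ofPred_eq, Finset.coe_biUnion, Set.mem_iUnion, Set.Finite.coe_toFinset,
      exists_prop]
    constructor
    · intro h
      refine ⟨_, h, ?_⟩
      have := (Set.ext_iff.1 (hfib _ h) x).1 rfl
      exact this
    · rintro ⟨f, hf, hx⟩
      have := (Set.ext_iff.1 (hfib _ hf) x).2 hx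
      rw [Set.mem_ofPred_eq] at this
      rwa [this]
  rw [hunion, Set.ncard_coe_finset, Finset.card_biUnion, Finset.sum_congr rfl (g := fun _ => n),
    Finset.sum_const, smul_eq_mul, numInvariants, Set.ncard_eq_toFinset_card _
      (invariants_finite A n), mul_comm]
  · intro f hf
    obtain ⟨hm, hi, hn, -⟩ := (invariants_finite A n).mem_toFinset.1 hf
    have h := card_rootSet_eq_natDegree (K := K) (PerfectField.separable_of_irreducible hi)
      (IsAlgClosed.splits _)
    rw [hn] at h
    rw [← h, ← Set.toFinset_card]
    congr 1
    ext x
    simp [mem_rootSet]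
  · intro f hf g hg hfg
    rw [Function.onFun, Finset.disjoint_left]
    intro x hx hx'
    apply hfg
    have h1 := (Set.ext_iff.1 (hfib f ((invariants_finite A n).mem_toFinset.1 hf)) x).2
      (by simpa [rootSet] using hx)
    have h2 := (Set.ext_iff.1 (hfib g ((invariants_finite A n).mem_toFinset.1 hg)) x).2
      (by simpa [rootSet] using hx')
    exact h1.symm.trans h2

end Frobenius

end MobiusPoly

namespace MobiusPoly

variable {F K : Type*} [Field F] [Field K] [Algebra F K]

/-! ### What type 4 provides: no rational eigenvalue, nonzero trace -/

section NoEigenvalue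

theorem entry_ne_zero_of_no_eigenvalue {A : GL (Fin 2) F}
    (hA : ∀ t : F, (t - A 0 0) * (t - A 1 1) ≠ A 0 1 * A 1 0) : A 0 1 ≠ 0 := by
  intro h
  exact hA (A 0 0) (by rw [h]; ring)

theorem pow_two_mk_eq_one_iff {A : GL (Fin 2) F}
    (hA : ∀ t : F, (t - A 0 0) * (t - A 1 1) ≠ A 0 1 * A 1 0) :
    (Matrix.ProjGenLinGroup.mk A : PGL(2, F)) ^ 2 = 1 ↔ A 0 0 + A 1 1 = 0 := by
  rw [← map_pow, mk_eq_one_iff_entries]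
  simp only [pow_two, Matrix.GeneralLinearGroup.coe_mul, Matrix.mul_apply, Fin.sum_univ_two]
  constructor
  · rintro ⟨h, -, -⟩
    refine (mul_eq_zero.1 (?_ : A 0 1 * (A 0 0 + A 1 1) = 0)).resolve_left
      (entry_ne_zero_of_no_eigenvalue hA)
    linear_combination h
  · intro h
    refine ⟨?_, ?_, ?_⟩
    · linear_combination A 0 1 * h
    · linear_combination A 1 0 * h
    · linear_combination (A 0 0 - A 1 1) * h

theorem two_lt_orderOf_mk [Finite F] {A : GL (Fin 2) F}
    (hA : ∀ t : F, (t - A 0 0) * (t - A 1 1) ≠ A 0 1 * A 1 0) (htr : A 0 0 + A 1 1 ≠ 0) :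
    2 < orderOf (Matrix.ProjGenLinGroup.mk A : PGL(2, F)) := by
  have : Finite PGL(2, F) := Finite.of_surjective _ Matrix.ProjGenLinGroup.mk_surjective
  have h0 := orderOf_pos (Matrix.ProjGenLinGroup.mk A : PGL(2, F))
  have h2 : ¬ orderOf (Matrix.ProjGenLinGroup.mk A : PGL(2, F)) ∣ 2 := by
    rwa [orderOf_dvd_iff_pow_eq_one, pow_two_mk_eq_one_iff hA]
  by_contra h
  apply h2
  generalize orderOf (Matrix.ProjGenLinGroup.mk A : PGL(2, F)) = D at h0 h
  interval_cases D <;> norm_num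

theorem pow_no_eigenvalue {A : GL (Fin 2) F}
    (hA : ∀ t : F, (t - A 0 0) * (t - A 1 1) ≠ A 0 1 * A 1 0) {l : ℕ}
    (hl : (Matrix.ProjGenLinGroup.mk (A ^ l) : PGL(2, F)) ≠ 1) (t : F) :
    (t - (A ^ l) 0 0) * (t - (A ^ l) 1 1) ≠ (A ^ l) 0 1 * (A ^ l) 1 0 := by
  obtain ⟨p, r, h00, h01, h10, h11⟩ := exists_pow_apply_eq A l
  have hr : r ≠ 0 := by
    rintro rfl
    exact hl ((mk_eq_one_iff_entries _).2 ⟨by rw [h01]; ring, by rw [h10]; ring,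
      by rw [h00, h11]; ring⟩)
  rw [h00, h01, h10, h11]
  intro h
  -- Since `A^l = p I + r A`, an eigenvalue `t` of `A^l` gives this eigenvalue of `A`.
  apply hA ((t - p) / r)
  field_simp
  linear_combination h

theorem pow_coprime_no_eigenvalue_and_trace_ne_zero [Finite F] {A : GL (Fin 2) F}
    (hA : ∀ t : F, (t - A 0 0) * (t - A 1 1) ≠ A 0 1 * A 1 0) (htr : A 0 0 + A 1 1 ≠ 0) {l : ℕ}
    (hl : l.Coprime (orderOf (Matrix.ProjGenLinGroup.mk A : PGL(2, F)))) :
    (∀ t : F, (t - (A ^ l) 0 0) * (t - (A ^ l) 1 1) ≠ (A ^ l) 0 1 * (A ^ l) 1 0) ∧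
      (A ^ l) 0 0 + (A ^ l) 1 1 ≠ 0 := by
  have h2 := two_lt_orderOf_mk hA htr
  have hne : (Matrix.ProjGenLinGroup.mk (A ^ l) : PGL(2, F)) ≠ 1 := by
    rw [map_pow, Ne, ← orderOf_dvd_iff_pow_eq_one]
    intro h
    have := Nat.Coprime.eq_one_of_dvd hl.symm h
    omega
  have hno := pow_no_eigenvalue hA hne
  refine ⟨hno, fun h => ?_⟩
  rw [← pow_two_mk_eq_one_iff hno, map_pow, ← pow_mul, ← orderOf_dvd_iff_pow_eq_one] at h
  have := Nat.le_of_dvd two_pos (hl.symm.dvd_of_dvd_mul_left h)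
  omega

theorem IsType4.no_eigenvalue {A : GL (Fin 2) F} (hA : IsType4 A) (t : F) :
    (t - A 0 0) * (t - A 1 1) ≠ A 0 1 * A 1 0 := by
  obtain ⟨-, α, β, hroots, ⟨-, hα⟩, ⟨-, hβ⟩, -⟩ := hA
  intro h
  have hmem : algebraMap F (AlgebraicClosure F) t ∈
      (A : Matrix (Fin 2) (Fin 2) F).charpoly.aroots (AlgebraicClosure F) := by
    rw [mem_aroots]
    refine ⟨(Matrix.charpoly_monic _).ne_zero, ?_⟩
    rw [aeval_algebraMap_apply, coe_aeval_eq_eval, Matrix.charpoly_fin_two, Matrix.trace_fin_two,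
      Matrix.det_fin_two]
    simp only [eval_add, eval_sub, eval_mul, eval_pow, eval_X, eval_C]
    rw [map_eq_zero]
    linear_combination h
  rw [hroots] at hmem
  simp only [Multiset.insert_eq_cons, Multiset.mem_cons, Multiset.mem_singleton] at hmem
  rcases hmem with h | h
  · exact hα ⟨t, h⟩
  · exact hβ ⟨t, h⟩

/-- With zero trace the characteristic polynomial is `x² + det`, so `{α, β}` is stable under
negation. This forces `β = -α`, even when `α = β`. -/
theorem IsType4.trace_ne_zero {A : GL (Fin 2) F} (hA : IsType4 A) : A 0 0 + A 1 1 ≠ 0 := by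
  obtain ⟨-, α, β, hroots, -, -, hαβ⟩ := hA
  intro h
  have key : ∀ x : AlgebraicClosure F, x = α ∨ x = β ↔
      x ^ 2 + algebraMap F _ (A 0 0 * A 1 1 - A 0 1 * A 1 0) = 0 := by
    intro x
    have : x = α ∨ x = β ↔
        x ∈ (A : Matrix (Fin 2) (Fin 2) F).charpoly.aroots (AlgebraicClosure F) := by
      rw [hroots]; simp
    rw [this, mem_aroots, and_iff_right (Matrix.charpoly_monic _).ne_zero,
      Matrix.charpoly_fin_two, Matrix.trace_fin_two, h, Matrix.det_fin_two]
    simp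
  have h1 := (key α).1 (Or.inl rfl)
  have h2 := (key β).1 (Or.inr rfl)
  have h3 := (key (-α)).2 (by rw [neg_sq, h1])
  have h4 : β = α ∨ β = -α := sq_eq_sq_iff_eq_or_eq_neg.1 (by linear_combination h2 - h1)
  rcases h4 with h4 | h4
  · rcases h3 with h3 | h3
    · exact hαβ (h4.trans h3.symm)
    · exact hαβ h3.symm
  · exact hαβ h4

end NoEigenvalue

/-! ### Solutions of `mob B x = x ^ q ^ m` -/

section Counting

/-- The polynomial whose roots outside the base field are the solutions of `mob B x = x ^ N`. -/
noncomputable def mobPoly (B : GL (Fin 2) F) (N : ℕ) : F[X] :=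
  C (B 0 1) * X ^ (N + 1) + C (B 1 1) * X ^ N - C (B 0 0) * X - C (B 1 0)

theorem aeval_mobPoly (B : GL (Fin 2) F) (N : ℕ) (x : K) : aeval x (mobPoly B N) =
    algebraMap F K (B 0 1) * x ^ (N + 1) + algebraMap F K (B 1 1) * x ^ N -
      algebraMap F K (B 0 0) * x - algebraMap F K (B 1 0) := by
  simp [mobPoly]

theorem natDegree_mobPoly {B : GL (Fin 2) F} (hb : B 0 1 ≠ 0) {N : ℕ} (hN : 0 < N) :
    (mobPoly B N).natDegree = N + 1 := by
  unfold mobPoly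
  compute_degree!
  rwa [if_neg hN.ne', sub_zero]

theorem separable_mobPoly (B : GL (Fin 2) F) {N : ℕ} (hN : (N : F) = 0) :
    (mobPoly B N).Separable := by
  have hdet := det_entries_ne_zero B
  have hN' : (N : F[X]) = 0 := by rw [← C_eq_natCast, hN, C_0]
  have hder : derivative (mobPoly B N) = C (B 0 1) * X ^ N - C (B 0 0) := by
    simp [mobPoly, derivative_X_pow, hN']
  rw [separable_def, hder]
  -- Bézout identity `b P - (b X + d) P' = ad - bc`, valid because `N = 0` in `F`.
  refine ⟨C (B 0 0 * B 1 1 - B 0 1 * B 1 0)⁻¹ * C (B 0 1),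
    C (B 0 0 * B 1 1 - B 0 1 * B 1 0)⁻¹ * (-(C (B 0 1) * X) - C (B 1 1)), ?_⟩
  have : C (B 0 0 * B 1 1 - B 0 1 * B 1 0)⁻¹ * C (B 0 0 * B 1 1 - B 0 1 * B 1 0) = 1 := by
    rw [← C_mul, inv_mul_cancel₀ hdet, C_1]
  rw [← this, mobPoly]
  simp only [C_sub, C_mul]
  ring

theorem mob_eq_pow_iff (B : GL (Fin 2) F) (N : ℕ) {x : K}
    (hx : x ∉ Set.range (algebraMap F K)) :
    mob B x = x ^ N ↔ aeval x (mobPoly B N) = 0 := by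
  rw [mob, div_eq_iff (denom_ne_zero B hx), aeval_mobPoly]
  constructor <;> intro h <;> linear_combination -h

variable [Finite F] [Algebra.IsAlgebraic F K]

theorem card_pow_cast_eq_zero {m : ℕ} (hm : 0 < m) : ((Nat.card F ^ m : ℕ) : F) = 0 := by
  have := Fintype.ofFinite F
  rw [Nat.cast_pow, Nat.card_eq_fintype_card, FiniteField.cast_card_eq_zero, zero_pow hm.ne']

omit [Finite F] [Algebra.IsAlgebraic F K] in
theorem natDegree_minpoly_ne_one_iff (x : K) :
    (minpoly F x).natDegree ≠ 1 ↔ x ∉ Set.range (algebraMap F K) := by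
  rw [Ne, minpoly.natDegree_eq_one_iff]
  rfl

omit [Algebra.IsAlgebraic F K] in
theorem notMem_range_of_aeval_mobPoly {B : GL (Fin 2) F}
    (hB : ∀ t : F, (t - B 0 0) * (t - B 1 1) ≠ B 0 1 * B 1 0) {m : ℕ} {x : K}
    (hx : aeval x (mobPoly B (Nat.card F ^ m)) = 0) : x ∉ Set.range (algebraMap F K) := by
  rintro ⟨y, rfl⟩
  have hy : y ^ Nat.card F ^ m = y := by
    have := Fintype.ofFinite F
    rw [Nat.card_eq_fintype_card, FiniteField.pow_card_pow]
  rw [aeval_algebraMap_apply, map_eq_zero, aeval_mobPoly, pow_succ, hy] at hx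
  simp only [Algebra.algebraMap_self, RingHom.id_apply] at hx
  -- A rational root `y` is fixed by the Möbius map, which makes `b y + d` an eigenvalue of `B`.
  exact hB (B 0 1 * y + B 1 1) (by linear_combination B 0 1 * hx)

/-- On points of degree two an even power of Frobenius is the identity. The equation thus cuts out
the fixed points of the Möbius map, the two roots of an irreducible quadratic. -/
theorem ncard_natDegree_two_of_even [IsAlgClosed K] {B : GL (Fin 2) F}
    (hB : ∀ t : F, (t - B 0 0) * (t - B 1 1) ≠ B 0 1 * B 1 0) {m : ℕ} (hm : Even m) :
    {x : K | aeval x (mobPoly B (Nat.card F ^ m)) = 0 ∧ (minpoly F x).natDegree = 2}.ncard = 2 := by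
  have hb := entry_ne_zero_of_no_eigenvalue hB
  have hdeg : (mobPoly B 1).natDegree = 2 := natDegree_mobPoly hb one_pos
  have hirr : Irreducible (mobPoly B 1) := by
    refine irreducible_of_degree_le_three_of_not_isRoot (by rw [hdeg]; simp) fun y hy => ?_
    refine notMem_range_of_aeval_mobPoly (K := F) (m := 0) hB (x := y) ?_ ⟨y, rfl⟩
    rwa [pow_zero, coe_aeval_eq_eval]
  have hset : {x : K | aeval x (mobPoly B (Nat.card F ^ m)) = 0 ∧ (minpoly F x).natDegree = 2} =
      (mobPoly B 1).rootSet K := by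
    ext x
    rw [Set.mem_ofPred_eq, mem_rootSet_of_ne hirr.ne_zero]
    have h2 : (minpoly F x).natDegree = 2 → (aeval x (mobPoly B (Nat.card F ^ m)) = 0 ↔
        aeval x (mobPoly B 1) = 0) := by
      intro h
      have := (pow_card_pow_eq_self_iff (F := F) x m).2 (h ▸ hm.two_dvd)
      rw [aeval_mobPoly, aeval_mobPoly, pow_succ, this, pow_succ, pow_one]
    constructor
    · rintro ⟨h, h'⟩
      exact (h2 h').1 h
    · intro h
      have h' : (minpoly F x).natDegree = 2 := by
        have e := minpoly.eq_of_irreducible hirr h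
        rw [← e, natDegree_mul_C (inv_ne_zero (leadingCoeff_ne_zero.2 hirr.ne_zero)), hdeg]
      exact ⟨(h2 h').2 h, h'⟩
  rw [hset, ← Nat.card_coe_set_eq, Nat.card_eq_fintype_card,
    card_rootSet_eq_natDegree (PerfectField.separable_of_irreducible hirr) (IsAlgClosed.splits _),
    hdeg]

theorem natDegree_ne_two_of_odd {B : GL (Fin 2) F} (htr : B 0 0 + B 1 1 ≠ 0) {m : ℕ}
    (hm : Odd m) {x : K} (hx : aeval x (mobPoly B (Nat.card F ^ m)) = 0) :
    (minpoly F x).natDegree ≠ 2 := by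
  intro h
  obtain ⟨σ, hσ⟩ := exists_algHom_eq_pow_card (F := F) (K := K)
  obtain ⟨k, rfl⟩ := hm
  have e1 : x ^ Nat.card F ^ (2 * k + 1) = σ x := by
    rw [pow_succ, pow_mul, (pow_card_pow_eq_self_iff (F := F) x (2 * k)).2 (h ▸ ⟨k, rfl⟩), hσ]
  have e2 : σ (σ x) = x := by
    rw [hσ, hσ, ← pow_mul, ← pow_two, (pow_card_pow_eq_self_iff (F := F) x 2).2 (h ▸ dvd_rfl)]
  rw [aeval_mobPoly, pow_succ, e1] at hx
  have hx' := congrArg σ hx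
  simp only [map_sub, map_add, map_mul, AlgHom.commutes, e2, map_zero] at hx'
  -- Conjugation swaps `x` and `σ x` in the equation. Subtracting the two versions leaves the trace
  -- times `σ x - x`.
  have h0 : algebraMap F K (B 0 0 + B 1 1) * (σ x - x) = 0 := by
    rw [map_add]
    linear_combination hx - hx'
  rcases mul_eq_zero.1 h0 with h0 | h0
  · exact htr ((map_eq_zero (algebraMap F K)).1 h0)
  · rw [sub_eq_zero, hσ, ← pow_one (Nat.card F), pow_card_pow_eq_self_iff, h] at h0
    omega

theorem ncard_mob_eq_pow [IsAlgClosed K] {B : GL (Fin 2) F}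
    (hB : ∀ t : F, (t - B 0 0) * (t - B 1 1) ≠ B 0 1 * B 1 0) (htr : B 0 0 + B 1 1 ≠ 0)
    {m : ℕ} (hm : 0 < m) :
    {x : K | 2 < (minpoly F x).natDegree ∧ mob B x = x ^ Nat.card F ^ m}.Finite ∧
    ({x : K | 2 < (minpoly F x).natDegree ∧ mob B x = x ^ Nat.card F ^ m}.ncard : ℚ) =
      (Nat.card F : ℚ) ^ m + (-1) ^ (m + 1) := by
  have hb := entry_ne_zero_of_no_eigenvalue hB
  have hN : 0 < Nat.card F ^ m := pow_pos Nat.card_pos m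
  have hdeg := natDegree_mobPoly hb hN
  have hne : mobPoly B (Nat.card F ^ m) ≠ 0 := by
    intro h
    rw [h, natDegree_zero] at hdeg
    omega
  set E := {x : K | aeval x (mobPoly B (Nat.card F ^ m)) = 0 ∧ (minpoly F x).natDegree = 2}
  set T := {x : K | 2 < (minpoly F x).natDegree ∧ mob B x = x ^ Nat.card F ^ m}
  have hS : ((mobPoly B (Nat.card F ^ m)).rootSet K).ncard = Nat.card F ^ m + 1 := by
    rw [← Nat.card_coe_set_eq, Nat.card_eq_fintype_card,
      card_rootSet_eq_natDegree (separable_mobPoly B (card_pow_cast_eq_zero hm))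
        (IsAlgClosed.splits _), hdeg]
  have hTE : T ∪ E = (mobPoly B (Nat.card F ^ m)).rootSet K := by
    ext x
    rw [Set.mem_union, mem_rootSet_of_ne hne]
    constructor
    · rintro (⟨h, h'⟩ | ⟨h, -⟩)
      · rwa [mob_eq_pow_iff B _ (notMem_range_of_one_lt_natDegree (F := F) (by omega))] at h'
      · exact h
    · intro h
      have hx := notMem_range_of_aeval_mobPoly hB h
      have h1 := (natDegree_minpoly_ne_one_iff (F := F) x).2 hx
      have h0 := minpoly.natDegree_pos (Algebra.IsIntegral.isIntegral (R := F) x)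
      by_cases h2 : (minpoly F x).natDegree = 2
      · exact Or.inr ⟨h, h2⟩
      · exact Or.inl ⟨by omega, (mob_eq_pow_iff B _ hx).2 h⟩
  have hfin := rootSet_finite (mobPoly B (Nat.card F ^ m)) K
  have hT : T.Finite := hfin.subset (hTE ▸ Set.subset_union_left)
  have hE : E.Finite := hfin.subset (hTE ▸ Set.subset_union_right)
  have hdisj : Disjoint T E := by
    rw [Set.disjoint_left]
    rintro x ⟨h, -⟩ ⟨-, h'⟩
    omega
  have hcard := Set.ncard_union_eq hdisj hT hE
  rw [hTE, hS] at hcard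
  refine ⟨hT, ?_⟩
  rcases Nat.even_or_odd m with he | ho
  · rw [ncard_natDegree_two_of_even hB he] at hcard
    have : (Nat.card F : ℚ) ^ m + 1 = T.ncard + 2 := by exact_mod_cast hcard
    rw [he.add_one.neg_one_pow]
    linarith
  · have hE0 : E = ∅ := Set.eq_empty_iff_forall_notMem.2
      fun x hx => natDegree_ne_two_of_odd htr ho hx.1 hx.2
    rw [hE0, Set.ncard_empty] at hcard
    have : (Nat.card F : ℚ) ^ m + 1 = T.ncard + 0 := by exact_mod_cast hcard
    rw [ho.add_one.neg_one_pow]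
    linarith

end Counting

end MobiusPoly

namespace MobiusPoly

/-! ### The double count -/

section Orbits

open Function

variable {F K : Type*} [Field F] [Finite F] [Field K] [Algebra F K] [Algebra.IsAlgebraic F K]
  [IsAlgClosed K] {A : GL (Fin 2) F}

theorem ncard_biUnion_finset {ι α : Type*} (s : Finset ι) (f : ι → Set α)
    (hf : ∀ i ∈ s, (f i).Finite) (hd : (s : Set ι).PairwiseDisjoint f) :
    (⋃ i ∈ s, f i).ncard = ∑ i ∈ s, (f i).ncard := by
  have := s.finite_toSet.ncard_biUnion hf hd
  rw [finsum_mem_coe_finset] at this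
  exact this

omit [IsAlgClosed K] in
theorem finite_minpoly_mem_invariants (A : GL (Fin 2) F) (n : ℕ) :
    {x : K | minpoly F x ∈ invariants A n}.Finite := by
  refine ((invariants_finite A n).biUnion fun f _ => f.rootSet_finite K).subset fun x hx => ?_
  exact Set.mem_biUnion hx ((mem_rootSet_of_ne
    (minpoly.ne_zero (Algebra.IsIntegral.isIntegral x))).2 (minpoly.aeval F x))

theorem ncard_exists_coprime_iterate_eq
    (hA : ∀ t : F, (t - A 0 0) * (t - A 1 1) ≠ A 0 1 * A 1 0) (htr : A 0 0 + A 1 1 ≠ 0)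
    {D : ℕ} (hD : D = orderOf (Matrix.ProjGenLinGroup.mk A : PGL(2, F))) {m : ℕ} (hm : 0 < m) :
    ({x : K | 2 < (minpoly F x).natDegree ∧
      ∃ l, l.Coprime D ∧ (mob A)^[l] x = (· ^ Nat.card F)^[m] x}.ncard : ℚ) =
      (Nat.totient D : ℚ) * ((Nat.card F : ℚ) ^ m + (-1) ^ (m + 1)) := by
  have hD0 : 0 < D := by have := two_lt_orderOf_mk hA htr; omega
  let T : ℕ → Set K := fun l =>
    {x : K | 2 < (minpoly F x).natDegree ∧ mob (A ^ l) x = x ^ Nat.card F ^ m}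
  have hT : ∀ l, l.Coprime D → (T l).Finite ∧
      ((T l).ncard : ℚ) = (Nat.card F : ℚ) ^ m + (-1) ^ (m + 1) := by
    intro l hl
    obtain ⟨h1, h2⟩ := pow_coprime_no_eigenvalue_and_trace_ne_zero hA htr (hD ▸ hl)
    exact ncard_mob_eq_pow h1 h2 hm
  have hmem : ∀ l x, x ∈ T l ↔
      2 < (minpoly F x).natDegree ∧ (mob A)^[l] x = (· ^ Nat.card F)^[m] x := by
    intro l x
    refine and_congr_right fun hx => ?_
    rw [iterate_mob A (notMem_range_of_one_lt_natDegree (F := F) (by omega)), pow_iterate]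
  have hunion : {x : K | 2 < (minpoly F x).natDegree ∧
      ∃ l, l.Coprime D ∧ (mob A)^[l] x = (· ^ Nat.card F)^[m] x} =
      ⋃ l ∈ (Finset.range D).filter D.Coprime, T l := by
    ext x
    simp only [Set.mem_iUnion, hmem, Finset.mem_filter, Finset.mem_range, exists_prop,
      Set.mem_ofPred_eq]
    constructor
    · rintro ⟨hx, l, hl, h⟩
      refine ⟨l % D, ⟨Nat.mod_lt _ hD0, ?_⟩, hx, ?_⟩
      -- Only `l` mod `D` matters, because `mob A` has period `D` at `x`.
      · rwa [Nat.Coprime, Nat.gcd_comm, ← Nat.gcd_rec, Nat.gcd_comm]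
      · rw [← h]
        conv_rhs => rw [← iterate_mod_minimalPeriod_eq, minimalPeriod_mob A hx, ← hD]
    · rintro ⟨l, ⟨-, hl⟩, hx, h⟩
      exact ⟨hx, l, hl.symm, h⟩
  rw [hunion, ncard_biUnion_finset _ _
    (fun l hl => (hT l (Finset.mem_filter.1 hl).2.symm).1), Nat.cast_sum,
    Finset.sum_congr rfl fun l hl => (hT l (Finset.mem_filter.1 hl).2.symm).2,
    Finset.sum_const, nsmul_eq_mul, Nat.totient]
  intro i hi j hj hij
  rw [Function.onFun, Set.disjoint_left]
  intro x hxi hxj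
  rw [hmem] at hxi hxj
  have hi' := Finset.mem_range.1 (Finset.mem_filter.1 hi).1
  have hj' := Finset.mem_range.1 (Finset.mem_filter.1 hj).1
  have hper := minimalPeriod_mob A hxi.1
  rw [← hD] at hper
  exact hij ((iterate_eq_iterate_iff_of_lt_minimalPeriod (hper.symm ▸ hi') (hper.symm ▸ hj')).1
    (hxi.2.trans hxj.2.symm))

theorem ncard_exists_coprime_iterate_eq_sum
    (hA : ∀ t : F, (t - A 0 0) * (t - A 1 1) ≠ A 0 1 * A 1 0) (htr : A 0 0 + A 1 1 ≠ 0)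
    {D : ℕ} (hD : D = orderOf (Matrix.ProjGenLinGroup.mk A : PGL(2, F))) {m : ℕ} (hm : 0 < m) :
    {x : K | 2 < (minpoly F x).natDegree ∧
      ∃ l, l.Coprime D ∧ (mob A)^[l] x = (· ^ Nat.card F)^[m] x}.ncard =
      ∑ t ∈ m.divisors with Nat.gcd t D = 1,
        D * (m / t) * numInvariants A (D * (m / t)) := by
  have hD2 : 2 < D := hD ▸ two_lt_orderOf_mk hA htr
  -- Because `D > 2`, every degree in the sum lies in the range where the orbit criterion for
  -- invariance applies.
  have hlt : ∀ t, t ∣ m → 2 < D * (m / t) := fun t ht =>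
    hD2.trans_le (Nat.le_mul_of_pos_right _ (Nat.div_pos (Nat.le_of_dvd hm ht)
      (Nat.pos_of_dvd_of_pos ht hm)))
  have hunion : {x : K | 2 < (minpoly F x).natDegree ∧
      ∃ l, l.Coprime D ∧ (mob A)^[l] x = (· ^ Nat.card F)^[m] x} =
      ⋃ t ∈ m.divisors.filter (fun t => Nat.gcd t D = 1),
        {x : K | minpoly F x ∈ invariants A (D * (m / t))} := by
    ext x
    simp only [Set.mem_iUnion, Finset.mem_filter, exists_prop, Set.mem_ofPred_eq]
    have key : 2 < (minpoly F x).natDegree →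
        ((∃ l, l.Coprime D ∧ (mob A)^[l] x = (· ^ Nat.card F)^[m] x) ↔
        (∃ j, mob A x = (· ^ Nat.card F)^[j] x) ∧
          ∃ t, t ∣ m ∧ t.Coprime D ∧ (minpoly F x).natDegree = D * (m / t)) := by
      intro hx
      rw [← minimalPeriod_pow_card]
      exact exists_coprime_iterate_eq_iff (mob_commute_pow_card A)
        (by rw [minimalPeriod_pow_card]; omega) (hD ▸ minimalPeriod_mob A hx) (by omega) hm
    constructor
    · rintro ⟨hx, h⟩
      obtain ⟨hj, t, ht, htD, hn⟩ := (key hx).1 h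
      exact ⟨t, ⟨Nat.mem_divisors.2 ⟨ht, hm.ne'⟩, htD⟩,
        (minpoly_mem_invariants_iff A x (hlt t ht)).2 ⟨hn, hj⟩⟩
    · rintro ⟨t, ⟨ht, htD⟩, h⟩
      have ht := Nat.dvd_of_mem_divisors ht
      obtain ⟨hn, hj⟩ := (minpoly_mem_invariants_iff A x (hlt t ht)).1 h
      have hx : 2 < (minpoly F x).natDegree := hn ▸ hlt t ht
      exact ⟨hx, (key hx).2 ⟨hj, t, ht, htD, hn⟩⟩
  rw [hunion, ncard_biUnion_finset _ _ (fun t _ => finite_minpoly_mem_invariants A _)]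
  · exact Finset.sum_congr rfl fun t _ => card_roots_eq_mul_numInvariants A _
  · intro i hi j hj hij
    rw [Function.onFun, Set.disjoint_left]
    rintro x ⟨-, -, hxi, -⟩ ⟨-, -, hxj, -⟩
    apply hij
    have hi' := Nat.dvd_of_mem_divisors (Finset.mem_filter.1 hi).1
    have hj' := Nat.dvd_of_mem_divisors (Finset.mem_filter.1 hj).1
    have h := Nat.eq_of_mul_eq_mul_left (by omega : 0 < D) (hxi.symm.trans hxj)
    rw [← Nat.div_div_self hi' hm.ne', h, Nat.div_div_self hj' hm.ne']

theorem orderOf_mk_dvd_of_mem_invariants {n : ℕ} (hn : 2 < n) {f : F[X]}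
    (hf : f ∈ invariants A n) :
    orderOf (Matrix.ProjGenLinGroup.mk A : PGL(2, F)) ∣ n := by
  obtain ⟨x, hx⟩ := IsAlgClosed.exists_aeval_eq_zero (AlgebraicClosure F) f
    (degree_pos_of_irreducible hf.2.1).ne'
  obtain rfl := minpoly.eq_of_irreducible_of_monic hf.2.1 hx hf.1
  obtain ⟨h1, j, hj⟩ := (minpoly_mem_invariants_iff A x hn).1 hf
  have h := eq_div_gcd_of_commute (mob_commute_pow_card A)
    (by rw [minimalPeriod_pow_card]; omega) hj
  rw [minimalPeriod_mob A (by omega), minimalPeriod_pow_card, h1] at h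
  rw [h]
  exact Nat.div_dvd_of_dvd (Nat.gcd_dvd_left _ _)

end Orbits

end MobiusPoly

theorem mainTheorem4 {F : Type*} [Field F] [Finite F] (A : GL (Fin 2) F)
    (hA : MobiusPoly.IsType4 A) (D : ℕ)
    (hD : D = orderOf (Matrix.ProjGenLinGroup.mk A : PGL(2, F))) :
    (∀ n : ℕ, 2 < n → ¬ D ∣ n → MobiusPoly.numInvariants A n = 0) ∧
    (∀ m : ℕ, 1 ≤ m →
      (MobiusPoly.numInvariants A (D * m) : ℚ) =
        (Nat.totient D : ℚ) / ((D : ℚ) * (m : ℚ)) *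
          ∑ d ∈ m.divisors with Nat.gcd d D = 1,
            ((Nat.card F : ℚ) ^ (m / d) + (-1 : ℚ) ^ (m / d + 1)) *
              ((ArithmeticFunction.moebius d : ℤ) : ℚ)) := by
  have hno := hA.no_eigenvalue
  have htr := hA.trace_ne_zero
  constructor
  · intro n hn hDn
    rw [MobiusPoly.numInvariants, Set.ncard_eq_zero (MobiusPoly.invariants_finite A n),
      Set.eq_empty_iff_forall_notMem]
    intro f hf
    exact hDn (hD ▸ MobiusPoly.orderOf_mk_dvd_of_mem_invariants hn hf)
  · intro m hm
    have hD2 : 2 < D := hD ▸ MobiusPoly.two_lt_orderOf_mk hno htr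
    -- Here `g` counts the roots of the invariants of degree `D m`, so dividing by `D m` at the end
    -- counts the invariants themselves.
    have key := MobiusPoly.eq_sum_coprime_moebius (D := D)
      (f := fun m => (Nat.totient D : ℚ) * ((Nat.card F : ℚ) ^ m + (-1) ^ (m + 1)))
      (g := fun m => ((D * m * MobiusPoly.numInvariants A (D * m) : ℕ) : ℚ))
      (fun k hk => by
        rw [← MobiusPoly.ncard_exists_coprime_iterate_eq (K := AlgebraicClosure F) hno htr hD hk,
          MobiusPoly.ncard_exists_coprime_iterate_eq_sum hno htr hD hk, Nat.cast_sum]) hm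
    simp only [mul_assoc (Nat.totient D : ℚ), ← Finset.mul_sum] at key
    have hDm : (D : ℚ) * m ≠ 0 := by positivity
    rw [div_mul_eq_mul_div, eq_div_iff hDm, ← key]
    push_cast
    ring
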